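/- One seller sells $k\ge 1$ indivisible goods to one buyer with additive values. A $k$-good random valuation is a random variable $X=(X_1,\dots,X_k)$ with values in $\mathbb{R}_+^k$. A $k$-good mechanism is a pair of Borel-measurable functions $q:\mathbb{R}_+^k\to[0,1]^k$ (allocation) and $s:\mathbb{R}_+^k\to\mathbb{R}_+$ (payment; in particular there are no positive transfers to the buyer) such that, for all $x,y\in\mathbb{R}_+^k$, $q(x)\cdot x-s(x)\ge 0$ (individual rationality) and $q(x)\cdot x-s(x)\ge q(y)\cdot x-s(y)$ (incentive compatibility). It is deterministic if $q(x)\in\{0,1\}^k$ for all $x$. Its revenue from $X$ is $\mathbb{E}[s(X)]\in[0,\infty]$. Let $\mathrm{Rev}(X)$ be the supremum of the revenue over all $k$-good mechanisms, let $\mathrm{DRev}(X)$ be the supremum over the deterministic ones, and let $\mathrm{SRev}(X)=\mathrm{Rev}(X_1)+\dots+\mathrm{Rev}(X_k)$, where each $X_i$ is regarded as a one-good random valuation. Proposition. For every $k\ge 1$ and every $k$-good random valuation $X$, $$\mathrm{DRev}(X)\le \ln 4\cdot(2^k-1)\cdot \mathrm{SRev}(X)$$ (as an inequality in $[0,\infty]$).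 -/

import Mathlib

open MeasureTheory
open scoped NNReal ENNReal

namespace Auction

/-- A (direct, Borel-measurable) `k`-good mechanism `(q, s)`: an allocation function `q` and a
payment function `s` on the valuations `ℝ₊ᵏ`, satisfying individual rationality (IR), incentive
compatibility (IC) and no positive transfer (NPT). -/
structure Mechanism (k : ℕ) where
  /-- `q x i` is the probability that a buyer who reports `x` receives good `i`. -/
  q : (Fin k → ℝ≥0) → Fin k → ℝ
  /-- `s x` is the payment of a buyer who reports `x`. -/
  s : (Fin k → ℝ≥0) → ℝ
  measurable_q : Measurable q
  measurable_s : Measurable s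
  q_mem : ∀ x i, q x i ∈ Set.Icc (0 : ℝ) 1
  ir : ∀ x, 0 ≤ ∑ i, q x i * (x i : ℝ) - s x
  ic : ∀ x y, ∑ i, q y i * (x i : ℝ) - s y ≤ ∑ i, q x i * (x i : ℝ) - s x
  npt : ∀ x, 0 ≤ s x

/-- Every good is either fully allocated or not allocated at all. -/
def Mechanism.IsDeterministic {k : ℕ} (m : Mechanism k) : Prop :=
  ∀ x i, m.q x i = 0 ∨ m.q x i = 1

section

variable {Ω : Type*} [MeasurableSpace Ω]

/-- The expected payment `𝔼[s(X)] ∈ [0, ∞]`; payments are nonnegative, so nothing is truncated. -/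
noncomputable def Mechanism.revenue {k : ℕ} (m : Mechanism k) (P : Measure Ω)
    (X : Ω → Fin k → ℝ≥0) : ℝ≥0∞ :=
  ∫⁻ ω, ENNReal.ofReal (m.s (X ω)) ∂P

/-- The optimal revenue: the supremum over all mechanisms. -/
noncomputable def Rev {k : ℕ} (P : Measure Ω) (X : Ω → Fin k → ℝ≥0) : ℝ≥0∞ :=
  ⨆ m : Mechanism k, m.revenue P X

/-- The deterministic revenue: the supremum over all deterministic mechanisms. -/
noncomputable def DRev {k : ℕ} (P : Measure Ω) (X : Ω → Fin k → ℝ≥0) : ℝ≥0∞ :=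
  ⨆ (m : Mechanism k) (_ : m.IsDeterministic), m.revenue P X

/-- The separate revenue `Rev(X₁) + ⋯ + Rev(X_k)`, where each `Xᵢ` is regarded as a one-good
random valuation. -/
noncomputable def SRev {k : ℕ} (P : Measure Ω) (X : Ω → Fin k → ℝ≥0) : ℝ≥0∞ :=
  ∑ i, Rev P (fun ω (_ : Fin 1) => X ω i)

end

end Auction

namespace Auction

/-! The constant `2 ^ k - 1` already suffices, since `ln 4 ≥ 1`. Posted prices bound each tail: `t *
P(Xᵢ ≥ t) ≤ rᵢ = Rev(Xᵢ)`. `lintegral_payment_le` inducts on the number of goods using only these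
tail bounds. Single out the good `i` with the largest `rᵢ`. States not allocating `i` form an
instance with one good fewer. On those allocating `i`, split off the infimum payment `c`: collecting
`c` is controlled by the tail of the total value, and `s - c` is again an admissible payment for the
bundles without `i`. `two_pow_recursion` adds up the three pieces. -/

/-- Selling one good at the posted price `t`. -/
noncomputable def postedPrice (t : ℝ≥0) : Mechanism 1 where
  q x _ := if t ≤ x 0 then 1 else 0
  s x := if t ≤ x 0 then t else 0
  measurable_q := measurable_pi_iff.2 fun _ =>
    Measurable.ite (measurableSet_le measurable_const (measurable_pi_apply 0))
      measurable_const measurable_const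
  measurable_s := Measurable.ite (measurableSet_le measurable_const (measurable_pi_apply 0))
      measurable_const measurable_const
  q_mem x _ := by split_ifs <;> simp
  ir x := by
    by_cases h : t ≤ x 0 <;> simp [h]
  ic x y := by
    by_cases hx : t ≤ x 0 <;> by_cases hy : t ≤ y 0 <;> simp [hx, hy]
    exact (not_le.1 hx).le
  npt x := by split_ifs <;> simp

section

variable {Ω : Type*} [MeasurableSpace Ω]

theorem mul_measure_le_rev (P : Measure Ω) {Y : Ω → ℝ≥0} (hY : Measurable Y) (t : ℝ≥0) :
    t * P {ω | t ≤ Y ω} ≤ Rev P (fun ω (_ : Fin 1) => Y ω) := by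
  refine le_trans (le_of_eq ?_) (le_iSup _ (postedPrice t))
  have hS : MeasurableSet {ω | t ≤ Y ω} := measurableSet_le measurable_const hY
  rw [Mechanism.revenue, ← lintegral_indicator_const hS]
  refine lintegral_congr fun ω => ?_
  by_cases h : t ≤ Y ω <;> simp [postedPrice, h]

/-- If each `Y i` has tail at most `r i / t`, then the sum over `J` has tail at most
`#J * (∑ i ∈ J, r i) / t`, without any independence. -/
theorem mul_measure_sum_le {ι : Type*} (P : Measure Ω) (Y : Ω → ι → ℝ≥0) (r : ι → ℝ≥0∞)
    (hr : ∀ i (t : ℝ≥0), t * P {ω | t ≤ Y ω i} ≤ r i) (J : Finset ι) (t : ℝ≥0) :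
    t * P {ω | t ≤ ∑ i ∈ J, Y ω i} ≤ J.card * ∑ i ∈ J, r i := by
  rcases J.eq_empty_or_nonempty with rfl | hJ
  · rcases eq_or_ne t 0 with rfl | ht <;> simp [*]
  have hn : (J.card : ℝ≥0) ≠ 0 := by simpa using hJ.ne_empty
  -- Pigeonhole: a sum reaching `t` has a term reaching the average `t / #J`.
  have hsub : {ω | t ≤ ∑ i ∈ J, Y ω i} ⊆ ⋃ i ∈ J, {ω | t / J.card ≤ Y ω i} := by
    intro ω hω
    by_contra hcon
    simp only [Set.mem_iUnion, Set.mem_ofPred_eq, exists_prop, not_exists, not_and, not_le] at hcon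
    have := Finset.sum_lt_sum_of_nonempty hJ hcon
    rw [Finset.sum_const, nsmul_eq_mul, mul_div_cancel₀ _ hn] at this
    exact absurd hω (not_le.2 this)
  have ht : (t : ℝ≥0∞) = J.card * ((t / J.card : ℝ≥0) : ℝ≥0∞) := by
    rw [← ENNReal.coe_natCast, ← ENNReal.coe_mul, mul_div_cancel₀ _ hn]
  calc t * P {ω | t ≤ ∑ i ∈ J, Y ω i}
      ≤ t * ∑ i ∈ J, P {ω | t / J.card ≤ Y ω i} := by
        gcongr
        exact (measure_mono hsub).trans (measure_biUnion_finset_le _ _)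
    _ = J.card * ∑ i ∈ J, ((t / J.card : ℝ≥0) : ℝ≥0∞) * P {ω | t / J.card ≤ Y ω i} := by
        rw [ht, mul_assoc, Finset.mul_sum]
    _ ≤ J.card * ∑ i ∈ J, r i := by
        gcongr with i hi
        exact hr i _

/-- Equivalent to `m² + m ≤ 2 (2 ^ m - 1)`, the slack that `two_pow_recursion` needs. -/
theorem sq_add_self_le_two_pow (m : ℕ) : m ^ 2 + m + 2 ≤ 2 ^ (m + 1) := by
  induction m with
  | zero => norm_num
  | succ m ih =>
    rw [pow_succ 2 (m + 1)]
    linarith [Nat.le_mul_self m, show (m + 1) ^ 2 = m * m + 2 * m + 1 by ring, pow_two m]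

/-- The revenue recursion: dropping the good with the largest `r` costs at most
`(m + 1) * (R + r)` and leaves two instances with `m` goods. -/
theorem two_pow_recursion {m : ℕ} {R r : ℝ≥0∞} (h : R ≤ m * r) :
    ((2 ^ m - 1 : ℕ) : ℝ≥0∞) * R + ((m + 1 : ℕ) * (R + r) + ((2 ^ m - 1 : ℕ) : ℝ≥0∞) * R)
      ≤ ((2 ^ (m + 1) - 1 : ℕ) : ℝ≥0∞) * (R + r) := by
  obtain ⟨N, hN⟩ : ∃ N, 2 ^ m = N + 1 := ⟨2 ^ m - 1, by have := Nat.one_le_two_pow (n := m); omega⟩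
  have hm := sq_add_self_le_two_pow m
  have h1 : 2 ^ (m + 1) - 1 = 2 * N + 1 := by rw [pow_succ, hN]; omega
  have h2 : m * m + m ≤ 2 * N := by
    rw [pow_succ 2 m, hN] at hm; linarith [pow_two m]
  have h3 : ((m * m + m : ℕ) : ℝ≥0∞) ≤ ((2 * N : ℕ) : ℝ≥0∞) := by exact_mod_cast h2
  rw [h1, hN, Nat.add_sub_cancel]
  push_cast at h3 ⊢
  calc (N : ℝ≥0∞) * R + ((m + 1) * (R + r) + N * R)
      = (2 * N + 1) * R + (m * R + (m + 1) * r) := by ring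
    _ ≤ (2 * N + 1) * R + (m * (m * r) + (m + 1) * r) := by gcongr
    _ = (2 * N + 1) * R + ((m * m + m) * r + r) := by ring
    _ ≤ (2 * N + 1) * R + (2 * N * r + r) := by gcongr
    _ = (2 * N + 1) * (R + r) := by ring

/-- The revenue that a deterministic outcome `(a, s)`, individually rational and incentive
compatible on a set `G` of states and allocating only goods of `J`, collects on `G`. -/
theorem lintegral_payment_le {ι : Type*} [DecidableEq ι] (P : Measure Ω) (Y : Ω → ι → ℝ≥0)
    (r : ι → ℝ≥0∞) (hr : ∀ i (t : ℝ≥0), t * P {ω | t ≤ Y ω i} ≤ r i) (n : ℕ) :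
    ∀ (J : Finset ι), J.card = n → ∀ (G : Set Ω), MeasurableSet G →
      ∀ (a : Ω → Finset ι), (∀ i, MeasurableSet {ω | i ∈ a ω}) → ∀ (s : Ω → ℝ), Measurable s →
      (∀ ω ∈ G, a ω ⊆ J) → (∀ ω ∈ G, 0 ≤ s ω) → (∀ ω ∈ G, s ω ≤ ∑ i ∈ a ω, (Y ω i : ℝ)) →
      (∀ ω ∈ G, ∀ ω' ∈ G,
        ∑ i ∈ a ω', (Y ω i : ℝ) - s ω' ≤ ∑ i ∈ a ω, (Y ω i : ℝ) - s ω) →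
      ∫⁻ ω in G, ENNReal.ofReal (s ω) ∂P ≤ ((2 ^ n - 1 : ℕ) : ℝ≥0∞) * ∑ i ∈ J, r i := by
  induction n with
  | zero =>
    intro J hJ G hG a _ s _ haJ _ hir _
    rw [Finset.card_eq_zero] at hJ
    subst hJ
    refine (setLIntegral_congr_fun (g := fun _ => 0) hG fun ω hω => ?_).le.trans (by simp)
    have h := hir ω hω
    rw [Finset.subset_empty.1 (haJ ω hω), Finset.sum_empty] at h
    exact ENNReal.ofReal_of_nonpos h
  | succ m ih =>
    intro J hJ G hG a ha s hs haJ hs0 hir hic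
    -- Maximality of `r i` serves only to give `hR'`, the hypothesis of the recursion.
    obtain ⟨i, hiJ, hmax⟩ := J.exists_max_image r (Finset.card_pos.1 (by omega))
    have hcard : (J.erase i).card = m := by rw [Finset.card_erase_of_mem hiJ, hJ]; rfl
    have hR : ∑ j ∈ J, r j = ∑ j ∈ J.erase i, r j + r i := (Finset.sum_erase_add J r hiJ).symm
    have hR' : ∑ j ∈ J.erase i, r j ≤ m * r i := by
      rw [← hcard, ← nsmul_eq_mul]
      exact Finset.sum_le_card_nsmul _ _ _ fun j hj => hmax j (Finset.mem_of_mem_erase hj)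
    have hout : ∫⁻ ω in G \ {ω | i ∈ a ω}, ENNReal.ofReal (s ω) ∂P
        ≤ ((2 ^ m - 1 : ℕ) : ℝ≥0∞) * ∑ j ∈ J.erase i, r j := by
      refine ih _ hcard _ (hG.diff (ha i)) a ha s hs ?_ (fun ω hω => hs0 ω hω.1)
        (fun ω hω => hir ω hω.1) (fun ω hω ω' hω' => hic ω hω.1 ω' hω'.1)
      exact fun ω hω => Finset.subset_erase.2 ⟨haJ ω hω.1, hω.2⟩
    have hin : ∫⁻ ω in G ∩ {ω | i ∈ a ω}, ENNReal.ofReal (s ω) ∂P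
        ≤ (m + 1 : ℕ) * (∑ j ∈ J, r j)
          + ((2 ^ m - 1 : ℕ) : ℝ≥0∞) * ∑ j ∈ J.erase i, r j := by
      set H := G ∩ {ω | i ∈ a ω}
      have hH : MeasurableSet H := hG.inter (ha i)
      rcases H.eq_empty_or_nonempty with hH0 | hne
      · simp [hH0]
      set c : ℝ := sInf (s '' H)
      have hc0 : 0 ≤ c := le_csInf (hne.image s) (by rintro _ ⟨ω, hω, rfl⟩; exact hs0 ω hω.1)
      have hcs : ∀ ω ∈ H, c ≤ s ω := fun ω hω =>
        csInf_le ⟨0, by rintro _ ⟨ω, hω, rfl⟩; exact hs0 ω hω.1⟩ ⟨ω, hω, rfl⟩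
      have herase : ∀ ω, ∀ ω' ∈ H, ∑ j ∈ (a ω').erase i, (Y ω j : ℝ)
          = ∑ j ∈ a ω', (Y ω j : ℝ) - Y ω i := fun ω ω' hω' =>
        eq_sub_of_add_eq (Finset.sum_erase_add _ _ hω'.2)
      have hbase : ENNReal.ofReal c * P H ≤ (m + 1 : ℕ) * (∑ j ∈ J, r j) := by
        rw [← hJ]
        refine le_trans ?_ (mul_measure_sum_le P Y r hr J c.toNNReal)
        refine mul_le_mul_right (measure_mono fun ω hω => ?_) _
        refine Real.toNNReal_le_iff_le_coe.2 ?_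
        rw [NNReal.coe_sum]
        exact ((hcs ω hω).trans (hir ω hω.1)).trans
          (Finset.sum_le_sum_of_subset_of_nonneg (haJ ω hω.1) fun _ _ _ => NNReal.coe_nonneg _)
      have hrest : ∫⁻ ω in H, ENNReal.ofReal (s ω - c) ∂P
          ≤ ((2 ^ m - 1 : ℕ) : ℝ≥0∞) * ∑ j ∈ J.erase i, r j := by
        refine ih _ hcard H hH (fun ω => (a ω).erase i) (fun j => ?_) _ (hs.sub_const c)
          (fun ω hω => Finset.erase_subset_erase i (haJ ω hω.1))
          (fun ω hω => sub_nonneg.2 (hcs ω hω)) (fun ω hω => ?_) (fun ω hω ω' hω' => ?_)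
        · simp only [Finset.mem_erase]
          exact (MeasurableSet.const (j ≠ i)).inter (ha j)
        -- The infimum `c` need not be attained, so `ω` is compared with every `ω' ∈ H`: mimicking
        -- `ω'` yields at least `Y ω i - s ω'`, because `i ∈ a ω'`.
        · suffices s ω - ∑ j ∈ (a ω).erase i, (Y ω j : ℝ) ≤ c by linarith
          refine le_csInf (hne.image s) ?_
          rintro _ ⟨ω', hω', rfl⟩
          have h1 := hic ω hω.1 ω' hω'.1
          have h2 : (Y ω i : ℝ) ≤ ∑ j ∈ a ω', (Y ω j : ℝ) :=
            Finset.single_le_sum (f := fun j => (Y ω j : ℝ))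
              (fun _ _ => NNReal.coe_nonneg _) hω'.2
          rw [herase ω ω hω]
          linarith
        -- Both bundles contain `i`, so `Y ω i` and `c` cancel from the incentive constraint.
        · have h1 := hic ω hω.1 ω' hω'.1
          simp only [herase ω ω hω, herase ω ω' hω']
          linarith
      calc ∫⁻ ω in H, ENNReal.ofReal (s ω) ∂P
          = ∫⁻ ω in H, (ENNReal.ofReal c + ENNReal.ofReal (s ω - c)) ∂P := by
            refine setLIntegral_congr_fun hH fun ω hω => ?_
            rw [← ENNReal.ofReal_add hc0 (sub_nonneg.2 (hcs ω hω)), add_sub_cancel]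
        _ = ENNReal.ofReal c * P H + ∫⁻ ω in H, ENNReal.ofReal (s ω - c) ∂P := by
            rw [lintegral_add_left measurable_const, setLIntegral_const]
        _ ≤ _ := add_le_add hbase hrest
    rw [← lintegral_inter_add_sdiff _ G (ha i), add_comm]
    refine (add_le_add hout hin).trans ?_
    rw [hR]
    exact two_pow_recursion hR'

theorem dRev_le_two_pow_sub_one_mul_sRev (P : Measure Ω) {k : ℕ} (X : Ω → Fin k → ℝ≥0)
    (hX : Measurable X) : DRev P X ≤ ((2 ^ k - 1 : ℕ) : ℝ≥0∞) * SRev P X := by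
  refine iSup₂_le fun M hM => ?_
  have hsum : ∀ x y : Fin k → ℝ≥0, ∑ i, M.q x i * (y i : ℝ)
      = ∑ i ∈ Finset.univ.filter (fun i => M.q x i = 1), (y i : ℝ) := by
    intro x y
    rw [Finset.sum_filter]
    refine Finset.sum_congr rfl fun i _ => ?_
    rcases hM x i with h | h <;> simp [h]
  rw [Mechanism.revenue, ← setLIntegral_univ]
  refine lintegral_payment_le P X (fun i => Rev P (fun ω (_ : Fin 1) => X ω i))
    (fun i t => mul_measure_le_rev P ((measurable_pi_apply i).comp hX) t) k Finset.univ (by simp)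
    Set.univ MeasurableSet.univ (fun ω => Finset.univ.filter (fun i => M.q (X ω) i = 1))
    (fun i => ?_) (fun ω => M.s (X ω)) (M.measurable_s.comp hX) (fun ω _ => Finset.subset_univ _)
    (fun ω _ => M.npt _) (fun ω _ => ?_) (fun ω _ ω' _ => ?_)
  · simp only [Finset.mem_filter, Finset.mem_univ, true_and]
    exact ((measurable_pi_apply i).comp (M.measurable_q.comp hX)) (measurableSet_singleton 1)
  · rw [← hsum]
    exact sub_nonneg.1 (M.ir (X ω))
  · rw [← hsum, ← hsum]
    exact M.ic (X ω) (X ω')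

end

end Auction

theorem mainTheorem9 {Ω : Type*} [MeasurableSpace Ω] (P : Measure Ω) [IsProbabilityMeasure P]
    (k : ℕ) (hk : 1 ≤ k) (X : Ω → Fin k → ℝ≥0) (hX : Measurable X) :
    Auction.DRev P X ≤
      ENNReal.ofReal (Real.log 4 * ((2 : ℝ) ^ k - 1)) * Auction.SRev P X := by
  refine (Auction.dRev_le_two_pow_sub_one_mul_sRev P X hX).trans ?_
  gcongr
  have h2 : (1 : ℝ) ≤ 2 ^ k := one_le_pow₀ (by norm_num)
  have h4 : (1 : ℝ) ≤ Real.log 4 := by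
    rw [Real.le_log_iff_exp_le (by norm_num)]
    linarith [Real.exp_one_lt_d9]
  rw [← ENNReal.ofReal_natCast]
  refine ENNReal.ofReal_le_ofReal ?_
  push_cast [Nat.one_le_two_pow]
  nlinarith
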